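/- Consider a regular tree network with $K>1$ levels rooted at a fusion center (FC), with $N_1\ge 1$ nodes at level $1$, where every node at level $k<K$ has $a_k\ge 2$ children, so that $N_{k+1}=a_kN_k$. At level $k$ there are $B_k$ Byzantine nodes; put $\alpha_k=B_k/N_k$ and assume $\sum_{k=1}^K\alpha_k\le 1$. A node at level $k$ makes a binary local decision which equals $1$ with probability $P_{fa}^k$ under $H_0$ and $P_d^k$ under $H_1$; a Byzantine at level $k$ turns a $0$ into a $1$ with probability $P_{1,0}^k$ and a $1$ into a $0$ with probability $P_{0,1}^k$. With $\beta_{1,0}^k=\sum_{l\le k}\alpha_lP_{1,0}^l$ and $\beta_{0,1}^k=\sum_{l\le k}\alpha_lP_{0,1}^l$, a decision originating from level $k$ reaches the FC as a $1$ with probability $$\pi_{1,0}^k=\beta_{1,0}^k(1-P_{fa}^k)+(1-\beta_{0,1}^k)P_{fa}^k\ \text{ under }H_0,\qquad \pi_{1,1}^k=\beta_{1,0}^k(1-P_d^k)+(1-\beta_{0,1}^k)P_d^k\ \text{ under }H_1,$$ and as a $0$ with probability $\pi_{0,h}^k=1-\pi_{1,h}^k$, $h\in\{0,1\}$; under each hypothesis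 all received decisions are independent. Assume that $\pi_{j,1}^k=0$ implies $\pi_{j,0}^k=0$ for all $j\in\{0,1\}$ and all $k$. Let $$D=\sum_{k=1}^K N_k\sum_{j\in\{0,1\}}\pi_{j,0}^k\log\frac{\pi_{j,0}^k}{\pi_{j,1}^k}$$ (with $0\log\frac{0}{q}=0$ for all $q\ge 0$). For $m\ge1$, let the $m$-fold network have the same $K$, $a_k$, $P_{fa}^k,P_d^k,P_{1,0}^k,P_{0,1}^k$, but $mN_1$ nodes at level $1$ and $mB_k$ Byzantines at level $k$ (so it has $mN_k$ nodes at level $k$ and the same $\pi_{j,h}^k$). Its FC uses the likelihood ratio test that decides $H_1$ if and only if $$\prod_{k=1}^K\left(\frac{\pi_{1,1}^k}{\pi_{1,0}^k}\right)^{s_k}\left(\frac{1-\pi_{1,1}^k}{1-\pi_{1,0}^k}\right)^{mN_k-s_k}>\eta,$$ where $s_k$ is the number of ones received from level $k$ (if the likelihood under $H_0$ vanishes, the test decides $H_1$ exactly when the likelihood under $H_1$ is positive), and where the real threshold $\eta$ minimizes the missed detection probability $P_M$ subject to the false alarm probability being at most $\delta$. Then for every fixed $\delta\in(0,1)$ the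 resulting minimum $P_M^{(m)}$ satisfies $$\lim_{m\to\infty}-\frac1m\log P_M^{(m)}=D,$$ and this exponent is optimal: the infimum of $P_M$ over all (possibly randomized) tests of the $m$-fold network with false alarm probability at most $\delta$ has the same exponent $D$. -/

import Mathlib

open Filter Topology

noncomputable section

/-- A `K`-level regular tree network with Byzantines, rooted at a fusion center (FC).
Levels are indexed by `Fin K`; the index `k` stands for the level `k + 1` below the FC. -/
structure TreeNetwork (K : ℕ) where
  /-- number `N₁` of nodes at the first level (the children of the FC) -/
  N₁ : ℕ
  /-- number of children of each node at a given level (irrelevant for the last, leaf level) -/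
  degree : Fin K → ℕ
  /-- attack configuration: number `B_k` of Byzantine nodes at each level -/
  B : Fin K → ℕ
  /-- local false alarm probability `P_fa^k = P(v = 1 | H₀)` -/
  Pfa : Fin K → ℝ
  /-- local detection probability `P_d^k = P(v = 1 | H₁)` -/
  Pd : Fin K → ℝ
  /-- flipping probability `P_{1,0}^k`: a Byzantine turns a decision `0` into `1` -/
  P10 : Fin K → ℝ
  /-- flipping probability `P_{0,1}^k`: a Byzantine turns a decision `1` into `0` -/
  P01 : Fin K → ℝ

namespace TreeNetwork

variable {K : ℕ}

/-- The number `N_k` of nodes at level `k`. -/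
def N (T : TreeNetwork K) (k : Fin K) : ℕ :=
  T.N₁ * ∏ l ∈ Finset.univ.filter (fun l => l < k), T.degree l

/-- The fraction `α_k = B_k / N_k` of Byzantines at level `k`. -/
def α (T : TreeNetwork K) (k : Fin K) : ℝ := (T.B k : ℝ) / (T.N k : ℝ)

/-- The standing assumptions: depth greater than one, all non-leaf nodes have at least two
children, the parameters are probabilities, and there are no more Byzantines than a
non-overlapping attack (at most one Byzantine on each path from a leaf to the FC) allows. -/
structure Admissible (T : TreeNetwork K) : Prop where
  one_lt_depth : 1 < K
  N₁_pos : 0 < T.N₁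
  two_le_degree : ∀ k : Fin K, k.val + 1 < K → 2 ≤ T.degree k
  Pfa_mem : ∀ k, T.Pfa k ∈ Set.Icc (0 : ℝ) 1
  Pd_mem : ∀ k, T.Pd k ∈ Set.Icc (0 : ℝ) 1
  P10_mem : ∀ k, T.P10 k ∈ Set.Icc (0 : ℝ) 1
  P01_mem : ∀ k, T.P01 k ∈ Set.Icc (0 : ℝ) 1
  nonoverlapping : ∑ k, T.α k ≤ 1

/-- `β_{1,0}^k`: probability that a decision `0` made at level `k` reaches the FC flipped. -/
def β10 (T : TreeNetwork K) (k : Fin K) : ℝ :=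
  ∑ l ∈ Finset.univ.filter (fun l => l ≤ k), T.α l * T.P10 l

/-- `β_{0,1}^k`: probability that a decision `1` made at level `k` reaches the FC flipped. -/
def β01 (T : TreeNetwork K) (k : Fin K) : ℝ :=
  ∑ l ∈ Finset.univ.filter (fun l => l ≤ k), T.α l * T.P01 l

/-- `P(v = 1 | H)` at level `k`. Hypotheses are Booleans: `false` is `H₀`, `true` is `H₁`. -/
def localOne (T : TreeNetwork K) (k : Fin K) : Bool → ℝ
  | false => T.Pfa k
  | true => T.Pd k

/-- `T.recv k j h` is `π_{j,h}^k = P(z = j | H_h, k)`, the probability that a decision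
originating from level `k` reaches the FC with the value `j` under the hypothesis `H_h`. -/
def recv (T : TreeNetwork K) (k : Fin K) (j h : Bool) : ℝ :=
  let p := T.β10 k * (1 - T.localOne k h) + (1 - T.β01 k) * T.localOne k h
  if j then p else 1 - p

/-- The data at the FC: one received bit for each node of each level. -/
abbrev Data (T : TreeNetwork K) : Type := (k : Fin K) → Fin (T.N k) → Bool

/-- Probability of the data `z` under the hypothesis `H_h`: the received bits are independent,
and those from level `k` have the distribution `π_{·,h}^k`. -/
def law (T : TreeNetwork K) (h : Bool) (z : T.Data) : ℝ :=
  ∏ k, ∏ i, T.recv k (z k i) h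

/-- `s_k`: the number of received decisions from level `k` that are equal to one. -/
def ones (T : TreeNetwork K) (z : T.Data) (k : Fin K) : ℕ :=
  (Finset.univ.filter (fun i => z k i = true)).card

/-- Likelihood of the data under `H_h` as a function of the counts `s_k`. -/
def countLikelihood (T : TreeNetwork K) (h : Bool) (z : T.Data) : ℝ :=
  ∏ k, (T.recv k true h ^ T.ones z k * (1 - T.recv k true h) ^ (T.N k - T.ones z k))

open Classical in
/-- The likelihood ratio test with threshold `η` (value `1`: decide `H₁`; value `0`: decide `H₀`).
It is written without division, so that it also makes sense where the likelihood under `H₀`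
vanishes (the ratio is then `+∞`); see `lrt_eq_ratio` for the form with quotients. -/
def lrt (T : TreeNetwork K) (η : ℝ) (z : T.Data) : ℝ :=
  if η * T.countLikelihood false z < T.countLikelihood true z then 1 else 0

open Classical in
theorem lrt_eq_ratio (T : TreeNetwork K) (h0 : ∀ k, 0 < T.recv k true false)
    (h1 : ∀ k, T.recv k true false < 1) (η : ℝ) (z : T.Data) :
    T.lrt η z = if η < ∏ k, ((T.recv k true true / T.recv k true false) ^ T.ones z k *
      ((1 - T.recv k true true) / (1 - T.recv k true false)) ^ (T.N k - T.ones z k))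
      then 1 else 0 := by
  have hpos : 0 < T.countLikelihood false z :=
    Finset.prod_pos fun k _ => mul_pos (pow_pos (h0 k) _) (pow_pos (sub_pos.2 (h1 k)) _)
  have hq : (∏ k, ((T.recv k true true / T.recv k true false) ^ T.ones z k *
      ((1 - T.recv k true true) / (1 - T.recv k true false)) ^ (T.N k - T.ones z k))) =
      T.countLikelihood true z / T.countLikelihood false z := by
    simp only [countLikelihood, ← Finset.prod_div_distrib, div_pow, div_mul_div_comm]
  rw [hq]
  simp only [lrt, lt_div_iff₀ hpos]

/-- False alarm probability `P_F` of a (possibly randomized) test `φ`, where `φ z` is the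
probability of deciding `H₁` when the data are `z`. -/
def falseAlarm (T : TreeNetwork K) (φ : T.Data → ℝ) : ℝ := ∑ z, φ z * T.law false z

/-- Missed detection probability `P_M` of a (possibly randomized) test `φ`. -/
def missed (T : TreeNetwork K) (φ : T.Data → ℝ) : ℝ := ∑ z, (1 - φ z) * T.law true z

/-- Missed detection probability of the likelihood ratio test whose threshold minimizes
`P_M` subject to `P_F ≤ δ`. -/
def lrtMissed (T : TreeNetwork K) (δ : ℝ) : ℝ :=
  sInf {x | ∃ η : ℝ, T.falseAlarm (T.lrt η) ≤ δ ∧ x = T.missed (T.lrt η)}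

/-- Smallest missed detection probability of all (possibly randomized) tests subject to
`P_F ≤ δ`. -/
def optMissed (T : TreeNetwork K) (δ : ℝ) : ℝ :=
  sInf {x | ∃ φ : T.Data → ℝ, (∀ z, φ z ∈ Set.Icc (0 : ℝ) 1) ∧ T.falseAlarm φ ≤ δ ∧
    x = T.missed φ}

/-- `D = ∑_k N_k ∑_j π_{j,0}^k log (π_{j,0}^k / π_{j,1}^k)`. -/
def exponent (T : TreeNetwork K) : ℝ :=
  ∑ k, (T.N k : ℝ) *
    ∑ j : Bool, T.recv k j false * Real.log (T.recv k j false / T.recv k j true)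

/-- The network with `m N₁` level-one nodes that is grown from `T` with the same degrees, the same
local detectors and flipping probabilities, and `m B_k` Byzantines at each level: all `N_k`
are multiplied by `m`, and the fractions `α_k` (hence the `π_{j,h}^k`) do not change. -/
def grow (T : TreeNetwork K) (m : ℕ) : TreeNetwork K :=
  { T with N₁ := m * T.N₁, B := fun k => m * T.B k }

end TreeNetwork

end

/-! This is Stein's lemma for independent bits that are not identically distributed. Under H₀ the
log-likelihood ratio `logRatio` has mean `exponent` and variance `logRatioVariance`, and both are
multiplied by `m` in the `m`-fold network. By Chebyshev, a deviation of size `m * ε` has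
H₀-probability of order `1 / m`; off that event the H₁-law is the H₀-law times a factor between `exp
(-m(D + ε))` and `exp (-m(D - ε))`. Converse (`le_missed`): a test with false alarm at most `δ`
still decides H₀ on typical data of H₀-mass nearly `1 - δ`, and changing measure bounds its missed
detection below. Achievability (`falseAlarm_lrt_le`, `missed_lrt_le`): the threshold `exp (-m(D -
ε))` has vanishing false alarm, and missed detection at most the threshold. -/

section ProductWeights

variable {ι β : Type*} [Fintype ι] [DecidableEq ι] [Fintype β]

theorem sum_pi_prod (F : ι → β → ℝ) :
    ∑ z : ι → β, ∏ i, F i (z i) = ∏ i, ∑ b, F i b := by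
  classical
  rw [Finset.prod_univ_sum, Fintype.piFinset_univ]

theorem sum_pi_prod_eq_one (w : ι → β → ℝ) (hw : ∀ i, ∑ b, w i b = 1) :
    ∑ z : ι → β, ∏ i, w i (z i) = 1 := by
  rw [sum_pi_prod]
  exact Finset.prod_eq_one fun i _ => hw i

/-- Covariances of centred coordinate functions under a product of weights. -/
theorem sum_pi_prod_mul_mul (w g : ι → β → ℝ) (hw : ∀ i, ∑ b, w i b = 1)
    (hg : ∀ i, ∑ b, w i b * g i b = 0) (i j : ι) :
    ∑ z : ι → β, (∏ l, w l (z l)) * (g i (z i) * g j (z j)) =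
      if i = j then ∑ b, w i b * g i b ^ 2 else 0 := by
  -- Padding with factors `1` away from `i` and `j` turns the integrand into a product over
  -- coordinates, so the sum factorizes.
  have key : ∀ z : ι → β, (∏ l, w l (z l)) * (g i (z i) * g j (z j)) =
      ∏ l, (w l (z l) * ((if l = i then g l (z l) else 1) * (if l = j then g l (z l) else 1))) := by
    intro z
    rw [Finset.prod_mul_distrib, Finset.prod_mul_distrib, Finset.prod_ite_eq', Finset.prod_ite_eq']
    simp only [Finset.mem_univ, if_true]
  simp only [key]
  rw [sum_pi_prod fun l b => w l b * ((if l = i then g l b else 1) * (if l = j then g l b else 1))]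
  split_ifs with hij
  · subst hij
    rw [Finset.prod_eq_single i]
    · simp [sq]
    · intro l _ hl
      simp [hl, hw]
    · simp
  · refine Finset.prod_eq_zero (Finset.mem_univ i) ?_
    simp [hij, hg]

/-- Variances of independent summands add: the cross terms of the square vanish. -/
theorem sum_pi_prod_mul_sum_sq (w g : ι → β → ℝ) (hw : ∀ i, ∑ b, w i b = 1)
    (hg : ∀ i, ∑ b, w i b * g i b = 0) :
    ∑ z : ι → β, (∏ i, w i (z i)) * (∑ i, g i (z i)) ^ 2 = ∑ i, ∑ b, w i b * g i b ^ 2 := by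
  simp only [sq (∑ i, g i _), Finset.sum_mul_sum]
  simp only [Finset.mul_sum]
  rw [Finset.sum_comm]
  refine Finset.sum_congr rfl fun i _ => ?_
  rw [Finset.sum_comm]
  simp only [sum_pi_prod_mul_mul w g hw hg, Finset.sum_ite_eq, Finset.mem_univ, if_true]

end ProductWeights

/-! ### The law of the received data and its log-likelihood ratio -/

namespace TreeNetwork

variable {K : ℕ}

/-- The received bits have genuine distributions, and those under `H₀` are absolutely continuous
with respect to those under `H₁`. -/
structure Dominated (T : TreeNetwork K) : Prop where
  recv_nonneg : ∀ k j h, 0 ≤ T.recv k j h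
  recv_eq_zero : ∀ k j, T.recv k j true = 0 → T.recv k j false = 0

theorem sum_recv (T : TreeNetwork K) (k : Fin K) (h : Bool) : ∑ j, T.recv k j h = 1 := by
  simp [recv]

/-- Flattening the two indices into one makes the product-weight lemmas applicable. -/
theorem sum_data (T : TreeNetwork K) (F : T.Data → ℝ) :
    ∑ z, F z = ∑ y : ((s : (k : Fin K) × Fin (T.N k)) → Bool), F fun k i => y ⟨k, i⟩ :=
  (Equiv.sum_comp (Equiv.piCurry fun (k : Fin K) (_ : Fin (T.N k)) => Bool) F).symm

theorem sum_law (T : TreeNetwork K) (h : Bool) : ∑ z, T.law h z = 1 := by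
  rw [sum_data]
  rw [← sum_pi_prod_eq_one (fun (s : (k : Fin K) × Fin (T.N k)) b => T.recv s.1 b h)
    fun s => T.sum_recv s.1 h]
  refine Finset.sum_congr rfl fun y _ => ?_
  rw [Fintype.prod_sigma]
  rfl

theorem countLikelihood_eq_law (T : TreeNetwork K) (h : Bool) (z : T.Data) :
    T.countLikelihood h z = T.law h z := by
  refine Finset.prod_congr rfl fun k _ => ?_
  have hrw : ∀ i, T.recv k (z k i) h =
      if z k i = true then T.recv k true h else 1 - T.recv k true h := by
    intro i
    cases z k i <;> simp [recv]
  have hcard := Finset.card_filter_add_card_filter_not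
    (s := (Finset.univ : Finset (Fin (T.N k)))) (fun i => z k i = true)
  rw [Finset.card_univ, Fintype.card_fin] at hcard
  simp only [hrw, Finset.prod_ite, Finset.prod_const, ones]
  congr 2
  omega

/-- Log-likelihood ratio of a single bit received from level `k`. -/
noncomputable def bitLogRatio (T : TreeNetwork K) (k : Fin K) (j : Bool) : ℝ :=
  Real.log (T.recv k j false / T.recv k j true)

/-- Kullback-Leibler divergence between the distributions of a bit received from level `k`. -/
noncomputable def bitDivergence (T : TreeNetwork K) (k : Fin K) : ℝ :=
  ∑ j, T.recv k j false * T.bitLogRatio k j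

/-- Log-likelihood ratio of the data. -/
noncomputable def logRatio (T : TreeNetwork K) (z : T.Data) : ℝ := ∑ k, ∑ i, T.bitLogRatio k (z k i)

/-- Variance of the log-likelihood ratio under `H₀`. -/
noncomputable def logRatioVariance (T : TreeNetwork K) : ℝ :=
  ∑ k, (T.N k : ℝ) * ∑ j, T.recv k j false * (T.bitLogRatio k j - T.bitDivergence k) ^ 2

/-- Since `exponent` is the sum of `bitDivergence` over all bits, the deviation is a sum of
independent centred terms. -/
theorem sum_law_mul_logRatio_sub_sq (T : TreeNetwork K) :
    ∑ z, T.law false z * (T.logRatio z - T.exponent) ^ 2 = T.logRatioVariance := by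
  have h := sum_pi_prod_mul_sum_sq
    (fun (s : (k : Fin K) × Fin (T.N k)) b => T.recv s.1 b false)
    (fun s b => T.bitLogRatio s.1 b - T.bitDivergence s.1)
    (fun s => T.sum_recv s.1 false) (fun s => by
      simp only [mul_sub, Finset.sum_sub_distrib, ← Finset.sum_mul, T.sum_recv, one_mul]
      exact sub_self _)
  rw [Fintype.sum_sigma] at h
  simp only [Finset.sum_const, Finset.card_univ, Fintype.card_fin, nsmul_eq_mul] at h
  rw [sum_data]
  refine Eq.trans (Finset.sum_congr rfl fun y _ => ?_) h
  rw [Fintype.prod_sigma, Fintype.sum_sigma]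
  simp only [law, logRatio, exponent, Finset.sum_sub_distrib, Finset.sum_const, Finset.card_univ,
    Fintype.card_fin, nsmul_eq_mul]
  rfl

/-! ### Change of measure, Chebyshev and the converse -/

namespace Dominated

variable {T : TreeNetwork K}

theorem law_nonneg (hT : T.Dominated) (h : Bool) (z : T.Data) : 0 ≤ T.law h z :=
  Finset.prod_nonneg fun k _ => Finset.prod_nonneg fun _ _ => hT.recv_nonneg k _ h

/-- Where the H₀-law is nonzero, domination makes every factor positive under both hypotheses, so no
logarithm takes its default value. -/
theorem law_true_eq (hT : T.Dominated) {z : T.Data} (hz : T.law false z ≠ 0) :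
    T.law true z = Real.exp (-T.logRatio z) * T.law false z := by
  have h0 : ∀ k i, T.recv k (z k i) false ≠ 0 := fun k i =>
    Finset.prod_ne_zero_iff.1 (Finset.prod_ne_zero_iff.1 hz k (Finset.mem_univ k)) i
      (Finset.mem_univ i)
  simp only [law, logRatio, ← Finset.sum_neg_distrib, Real.exp_sum, ← Finset.prod_mul_distrib]
  refine Finset.prod_congr rfl fun k _ => Finset.prod_congr rfl fun i _ => ?_
  have hf := (hT.recv_nonneg k (z k i) false).lt_of_ne' (h0 k i)
  have ht := (hT.recv_nonneg k (z k i) true).lt_of_ne' fun h => h0 k i (hT.recv_eq_zero k _ h)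
  rw [bitLogRatio, Real.exp_neg, Real.exp_log (div_pos hf ht)]
  field_simp

open Classical in
theorem chebyshev (hT : T.Dominated) {t : ℝ} (ht : 0 < t) :
    ∑ z with t ≤ |T.logRatio z - T.exponent|, T.law false z ≤ T.logRatioVariance / t ^ 2 := by
  rw [le_div_iff₀ (by positivity), ← sum_law_mul_logRatio_sub_sq, Finset.sum_mul]
  calc _ ≤ ∑ z with t ≤ |T.logRatio z - T.exponent|,
        T.law false z * (T.logRatio z - T.exponent) ^ 2 := by
        refine Finset.sum_le_sum fun z hz => mul_le_mul_of_nonneg_left ?_ (hT.law_nonneg _ _)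
        rw [← sq_abs (T.logRatio z - T.exponent)]
        exact pow_le_pow_left₀ ht.le (Finset.mem_filter.1 hz).2 2
    _ ≤ _ := Finset.sum_le_sum_of_subset_of_nonneg (Finset.filter_subset _ _)
        fun z _ _ => mul_nonneg (hT.law_nonneg _ _) (sq_nonneg _)

/-- Strong converse: a lower bound for the missed detection probability of every test. -/
theorem le_missed (hT : T.Dominated) {δ t : ℝ} (ht : 0 < t) {φ : T.Data → ℝ}
    (hφ : ∀ z, φ z ∈ Set.Icc (0 : ℝ) 1) (hF : T.falseAlarm φ ≤ δ) :
    Real.exp (-(T.exponent + t)) * (1 - δ - T.logRatioVariance / t ^ 2) ≤ T.missed φ := by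
  classical
  have hsplit := Finset.sum_filter_add_sum_filter_not Finset.univ
    (fun z => t ≤ |T.logRatio z - T.exponent|) (fun z => (1 - φ z) * T.law false z)
  have htot : ∑ z, (1 - φ z) * T.law false z = 1 - T.falseAlarm φ := by
    simp only [sub_mul, one_mul, Finset.sum_sub_distrib, sum_law, falseAlarm]
  have hbad : ∑ z with t ≤ |T.logRatio z - T.exponent|, (1 - φ z) * T.law false z ≤
      T.logRatioVariance / t ^ 2 :=
    (Finset.sum_le_sum fun z _ => mul_le_of_le_one_left (hT.law_nonneg _ _)
      (by linarith [(hφ z).1])).trans (hT.chebyshev ht)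
  calc _ ≤ Real.exp (-(T.exponent + t)) *
        ∑ z with ¬ t ≤ |T.logRatio z - T.exponent|, (1 - φ z) * T.law false z :=
        mul_le_mul_of_nonneg_left (by linarith) (Real.exp_pos _).le
    _ ≤ ∑ z with ¬ t ≤ |T.logRatio z - T.exponent|, (1 - φ z) * T.law true z := by
        rw [Finset.mul_sum]
        refine Finset.sum_le_sum fun z hz => ?_
        rw [mul_left_comm]
        refine mul_le_mul_of_nonneg_left ?_ (by linarith [(hφ z).2])
        by_cases h0 : T.law false z = 0
        · rw [h0, mul_zero]
          exact hT.law_nonneg _ _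
        · rw [hT.law_true_eq h0]
          refine mul_le_mul_of_nonneg_right (Real.exp_le_exp.2 ?_) (hT.law_nonneg _ _)
          have := (abs_lt.1 (not_le.1 (Finset.mem_filter.1 hz).2)).2
          linarith
    _ ≤ _ := Finset.sum_le_sum_of_subset_of_nonneg (Finset.filter_subset _ _)
        fun z _ _ => mul_nonneg (by linarith [(hφ z).2]) (hT.law_nonneg _ _)

theorem missed_nonneg (hT : T.Dominated) {φ : T.Data → ℝ}
    (hφ : ∀ z, φ z ∈ Set.Icc (0 : ℝ) 1) : 0 ≤ T.missed φ :=
  Finset.sum_nonneg fun z _ => mul_nonneg (by linarith [(hφ z).2]) (hT.law_nonneg _ _)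

end Dominated

theorem lrt_mem (T : TreeNetwork K) (η : ℝ) (z : T.Data) : T.lrt η z ∈ Set.Icc (0 : ℝ) 1 := by
  unfold lrt
  split_ifs <;> simp

/-! ### Achievability and comparison of the two optima -/

namespace Dominated

variable {T : TreeNetwork K}

/-- On the H₀-support, deciding H₁ at this threshold forces `logRatio` below `exponent - t`, an
event covered by Chebyshev. -/
theorem falseAlarm_lrt_le (hT : T.Dominated) {t : ℝ} (ht : 0 < t) :
    T.falseAlarm (T.lrt (Real.exp (-(T.exponent - t)))) ≤ T.logRatioVariance / t ^ 2 := by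
  classical
  refine le_trans ?_ (hT.chebyshev ht)
  rw [falseAlarm, Finset.sum_filter]
  refine Finset.sum_le_sum fun z _ => ?_
  simp only [lrt, countLikelihood_eq_law]
  by_cases h0 : T.law false z = 0
  · simp [h0]
  split_ifs with h1 h2 h2
  · rw [one_mul]
  · rw [hT.law_true_eq h0] at h1
    have h3 := Real.exp_lt_exp.1 (lt_of_mul_lt_mul_right h1 (hT.law_nonneg _ _))
    have h4 := (abs_lt.1 (not_le.1 h2)).1
    linarith
  · rw [zero_mul]
    exact hT.law_nonneg _ _
  · rw [zero_mul]

/-- Wherever the test decides H₀, the H₁-law is at most `η` times the H₀-law. -/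
theorem missed_lrt_le (hT : T.Dominated) {η : ℝ} (hη : 0 ≤ η) : T.missed (T.lrt η) ≤ η := by
  calc T.missed (T.lrt η) ≤ ∑ z, η * T.law false z := by
        refine Finset.sum_le_sum fun z _ => ?_
        simp only [lrt, countLikelihood_eq_law]
        split_ifs with h
        · rw [sub_self, zero_mul]
          exact mul_nonneg hη (hT.law_nonneg _ _)
        · linarith
    _ = η := by rw [← Finset.mul_sum, sum_law, mul_one]

/-- Achievability: the likelihood ratio test with a suitable threshold. -/
theorem lrtMissed_le (hT : T.Dominated) {δ t : ℝ} (ht : 0 < t)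
    (hδ : T.logRatioVariance / t ^ 2 ≤ δ) :
    T.lrtMissed δ ≤ Real.exp (-(T.exponent - t)) := by
  refine le_trans (csInf_le ⟨0, ?_⟩ ⟨_, (hT.falseAlarm_lrt_le ht).trans hδ, rfl⟩)
    (hT.missed_lrt_le (Real.exp_pos _).le)
  rintro x ⟨η, -, rfl⟩
  exact hT.missed_nonneg (T.lrt_mem η)

/-- The variance bound supplies a feasible threshold; without one, `lrtMissed` would be the default
`sInf ∅ = 0`. -/
theorem optMissed_le_lrtMissed (hT : T.Dominated) {δ t : ℝ} (ht : 0 < t)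
    (hδ : T.logRatioVariance / t ^ 2 ≤ δ) : T.optMissed δ ≤ T.lrtMissed δ := by
  refine csInf_le_csInf ⟨0, ?_⟩ ⟨_, _, (hT.falseAlarm_lrt_le ht).trans hδ, rfl⟩ ?_
  · rintro x ⟨φ, hφ, -, rfl⟩
    exact hT.missed_nonneg hφ
  · rintro x ⟨η, hη, rfl⟩
    exact ⟨_, T.lrt_mem η, hη, rfl⟩

theorem le_optMissed (hT : T.Dominated) {δ t : ℝ} (hδ : 0 ≤ δ) (ht : 0 < t) :
    Real.exp (-(T.exponent + t)) * (1 - δ - T.logRatioVariance / t ^ 2) ≤ T.optMissed δ := by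
  -- Always deciding H₀ is feasible, so the infimum is over a nonempty set.
  refine le_csInf ⟨_, fun _ => 0, fun _ => ⟨le_rfl, zero_le_one⟩, ?_, rfl⟩ ?_
  · simpa [falseAlarm] using hδ
  · rintro x ⟨φ, hφ, hF, rfl⟩
    exact hT.le_missed ht hφ hF

end Dominated

/-! ### Scaling in `m` -/

section Grow

variable (T : TreeNetwork K) {m : ℕ}

theorem grow_N (k : Fin K) : (T.grow m).N k = m * T.N k := by
  simp [N, grow, mul_assoc]

theorem grow_α (hm : m ≠ 0) (k : Fin K) : (T.grow m).α k = T.α k := by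
  have hm' : (m : ℝ) ≠ 0 := Nat.cast_ne_zero.2 hm
  rw [α, grow_N]
  simp only [grow, Nat.cast_mul]
  exact mul_div_mul_left _ _ hm'

theorem grow_recv (hm : m ≠ 0) (k : Fin K) (j h : Bool) :
    (T.grow m).recv k j h = T.recv k j h := by
  have h1 : (T.grow m).β10 k = T.β10 k := by
    simp only [β10, grow_α T hm]
    rfl
  have h2 : (T.grow m).β01 k = T.β01 k := by
    simp only [β01, grow_α T hm]
    rfl
  have h3 : (T.grow m).localOne k h = T.localOne k h := by cases h <;> rfl
  simp only [recv, h1, h2, h3]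

theorem grow_exponent (hm : m ≠ 0) : (T.grow m).exponent = m * T.exponent := by
  simp only [exponent, grow_recv T hm, grow_N, Nat.cast_mul, Finset.mul_sum, mul_assoc]

theorem grow_logRatioVariance (hm : m ≠ 0) :
    (T.grow m).logRatioVariance = m * T.logRatioVariance := by
  simp only [logRatioVariance, bitDivergence, bitLogRatio, grow_recv T hm, grow_N, Nat.cast_mul,
    Finset.mul_sum, mul_assoc]

variable {T}

theorem Dominated.grow (hT : T.Dominated) (hm : m ≠ 0) : (T.grow m).Dominated where
  recv_nonneg k j h := by
    rw [grow_recv T hm]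
    exact hT.recv_nonneg k j h
  recv_eq_zero k j := by
    rw [grow_recv T hm, grow_recv T hm]
    exact hT.recv_eq_zero k j

end Grow

theorem α_nonneg (T : TreeNetwork K) (k : Fin K) : 0 ≤ T.α k :=
  div_nonneg (Nat.cast_nonneg _) (Nat.cast_nonneg _)

theorem sum_α_mul_mem {T : TreeNetwork K} (hα : ∑ k, T.α k ≤ 1) {p : Fin K → ℝ}
    (hp : ∀ k, p k ∈ Set.Icc (0 : ℝ) 1) (s : Finset (Fin K)) :
    ∑ l ∈ s, T.α l * p l ∈ Set.Icc (0 : ℝ) 1 := by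
  refine ⟨Finset.sum_nonneg fun l _ => mul_nonneg (T.α_nonneg l) (hp l).1, ?_⟩
  calc _ ≤ ∑ l ∈ s, T.α l :=
        Finset.sum_le_sum fun l _ => mul_le_of_le_one_right (T.α_nonneg l) (hp l).2
    _ ≤ ∑ l, T.α l :=
        Finset.sum_le_sum_of_subset_of_nonneg (Finset.subset_univ s) fun l _ _ => T.α_nonneg l
    _ ≤ 1 := hα

theorem Admissible.recv_nonneg {T : TreeNetwork K} (hT : T.Admissible) (k : Fin K) (j h : Bool) :
    0 ≤ T.recv k j h := by
  obtain ⟨a0, a1⟩ : T.β10 k ∈ Set.Icc (0 : ℝ) 1 := sum_α_mul_mem hT.nonoverlapping hT.P10_mem _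
  obtain ⟨b0, b1⟩ : T.β01 k ∈ Set.Icc (0 : ℝ) 1 := sum_α_mul_mem hT.nonoverlapping hT.P01_mem _
  obtain ⟨q0, q1⟩ : T.localOne k h ∈ Set.Icc (0 : ℝ) 1 := by
    cases h
    exacts [hT.Pfa_mem k, hT.Pd_mem k]
  cases j <;> simp only [recv, if_true, Bool.false_eq_true, if_false]
  -- With `q` the local probability of a one, the complement equals `(1 - β10) * (1 - q) + β01 * q`.
  · linarith [mul_nonneg (sub_nonneg.2 a1) (sub_nonneg.2 q1), mul_nonneg b0 q0]
  · linarith [mul_nonneg a0 (sub_nonneg.2 q1), mul_nonneg (sub_nonneg.2 b1) q0]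

theorem Dominated.eventually_bounds {T : TreeNetwork K} (hT : T.Dominated) {δ ε : ℝ}
    (hδ0 : 0 < δ) (hδ1 : δ < 1) (hε : 0 < ε) :
    ∀ᶠ m : ℕ in atTop, 0 < m ∧
      Real.exp (-(m * (T.exponent + ε))) * ((1 - δ) / 2) ≤ (T.grow m).optMissed δ ∧
      (T.grow m).optMissed δ ≤ (T.grow m).lrtMissed δ ∧
      (T.grow m).lrtMissed δ ≤ Real.exp (-(m * (T.exponent - ε))) := by
  have hlim : Tendsto (fun m : ℕ => T.logRatioVariance / ε ^ 2 / (m : ℝ)) atTop (𝓝 0) :=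
    tendsto_const_div_atTop_nhds_zero_nat _
  filter_upwards [eventually_gt_atTop 0, hlim.eventually_le_const hδ0,
    hlim.eventually_le_const (show 0 < (1 - δ) / 2 by linarith)] with m hm h1 h2
  have hm0 : m ≠ 0 := hm.ne'
  have hmR : (0 : ℝ) < m := Nat.cast_pos.2 hm
  have ht : 0 < (m : ℝ) * ε := mul_pos hmR hε
  have hG := hT.grow hm0
  -- With `t = m * ε` the Chebyshev bound decays like `1 / m`; once it is below `(1 - δ) / 2`, the
  -- converse keeps the constant `(1 - δ) / 2`.
  have hV : (T.grow m).logRatioVariance / ((m : ℝ) * ε) ^ 2 =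
      T.logRatioVariance / ε ^ 2 / (m : ℝ) := by
    rw [grow_logRatioVariance T hm0]
    field_simp
  refine ⟨hm, ?_, hG.optMissed_le_lrtMissed ht (hV.trans_le h1), ?_⟩
  · refine le_trans ?_ (hG.le_optMissed hδ0.le ht)
    rw [hV, grow_exponent T hm0, mul_add]
    exact mul_le_mul_of_nonneg_left (by linarith) (Real.exp_pos _).le
  · have := hG.lrtMissed_le ht (hV.trans_le h1)
    rwa [grow_exponent T hm0, ← mul_sub] at this

end TreeNetwork

/-- The constant `c` costs only `-log c / m`, which tends to `0`; half of the tolerance absorbs it.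
The lower bound also keeps `P m` positive. -/
theorem tendsto_neg_log_div {P : ℕ → ℝ} {D c : ℝ} (hc : 0 < c)
    (h : ∀ ε > 0, ∀ᶠ m : ℕ in atTop, 0 < m ∧ Real.exp (-(m * (D + ε))) * c ≤ P m ∧
      P m ≤ Real.exp (-(m * (D - ε)))) :
    Tendsto (fun m : ℕ => -Real.log (P m) / (m : ℝ)) atTop (𝓝 D) := by
  have hlim : Tendsto (fun m : ℕ => -Real.log c / (m : ℝ)) atTop (𝓝 0) :=
    tendsto_const_div_atTop_nhds_zero_nat _
  rw [Metric.tendsto_nhds]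
  intro ε hε
  filter_upwards [h (ε / 2) (half_pos hε), hlim.eventually_lt_const (half_pos hε)]
    with m ⟨hm, hl, hu⟩ hcm
  have hmR : (0 : ℝ) < m := Nat.cast_pos.2 hm
  have hpos : 0 < Real.exp (-(m * (D + ε / 2))) * c := mul_pos (Real.exp_pos _) hc
  have hl' := Real.log_le_log hpos hl
  have hu' := Real.log_le_log (hpos.trans_le hl) hu
  rw [Real.log_mul (Real.exp_pos _).ne' hc.ne', Real.log_exp] at hl'
  rw [Real.log_exp] at hu'
  rw [div_lt_iff₀ hmR] at hcm
  rw [Real.dist_eq, abs_sub_lt_iff, sub_lt_iff_lt_add, sub_lt_comm, div_lt_iff₀ hmR,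
    lt_div_iff₀ hmR]
  have := mul_pos hmR hε
  constructor <;> linarith

theorem proposition1 {K : ℕ} (T : TreeNetwork K) (hT : T.Admissible)
    (hfin : ∀ (k : Fin K) (j : Bool), T.recv k j true = 0 → T.recv k j false = 0)
    (δ : ℝ) (hδ0 : 0 < δ) (hδ1 : δ < 1) :
    Tendsto (fun m : ℕ => -Real.log ((T.grow m).lrtMissed δ) / (m : ℝ)) atTop (𝓝 T.exponent) ∧
      Tendsto (fun m : ℕ => -Real.log ((T.grow m).optMissed δ) / (m : ℝ)) atTop
        (𝓝 T.exponent) := by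
  have hD : T.Dominated := ⟨hT.recv_nonneg, hfin⟩
  have hc : 0 < (1 - δ) / 2 := by linarith
  constructor <;> refine tendsto_neg_log_div hc fun ε hε => ?_
  · filter_upwards [hD.eventually_bounds hδ0 hδ1 hε] with m ⟨hm, h1, h2, h3⟩
    exact ⟨hm, h1.trans h2, h3⟩
  · filter_upwards [hD.eventually_bounds hδ0 hδ1 hε] with m ⟨hm, h1, h2, h3⟩
    exact ⟨hm, h1, h2.trans h3⟩
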